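/- For a positive integer $n$ let $S(n)^*=\{x^2 : x\in\mathbb Z/n\mathbb Z\}\setminus\{0\}$ be the set of non-zero squares in $\mathbb Z_n=\mathbb Z/n\mathbb Z$. Let $C_{S(n)^*}$ denote the least positive integer $k$ such that every sequence $(x_1,\dots,x_k)$ of $k$ elements of $\mathbb Z_n$ has an $S(n)^*$-weighted zero-sum subsequence of consecutive terms, i.e. there are indices $1\le i\le j\le k$ and weights $a_i,a_{i+1},\dots,a_j\in S(n)^*$ with $a_ix_i+a_{i+1}x_{i+1}+\cdots+a_jx_j=0$ in $\mathbb Z_n$. Let $n=m^2$, where $m>1$ is an odd squarefree integer. Then $C_{S(n)^*}=9$. -/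

import Mathlib

/-- The sequence `x` of length `k` in the `R`-module `M`, restricted to the index set `I`, is an
`A`-weighted zero-sum subsequence: `I` is non-empty and there are weights `a i ∈ A` for `i ∈ I`
with `∑ i ∈ I, a i • x i = 0`. -/
def IsWeightedZeroSum {R M : Type*} [Ring R] [AddCommGroup M] [Module R M] (A : Set R) {k : ℕ}
    (x : Fin k → M) (I : Finset (Fin k)) : Prop :=
  I.Nonempty ∧ ∃ a : Fin k → R, (∀ i ∈ I, a i ∈ A) ∧ ∑ i ∈ I, a i • x i = 0

/-- The sequence `x` has an `A`-weighted zero-sum subsequence of consecutive terms. -/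
def HasConsecutiveWeightedZeroSum {R M : Type*} [Ring R] [AddCommGroup M] [Module R M]
    (A : Set R) {k : ℕ} (x : Fin k → M) : Prop :=
  ∃ i j : Fin k, IsWeightedZeroSum A x (Finset.Icc i j)

/-- The constant `C_A(M)`: the least positive integer `k` such that every sequence of length `k`
in `M` has an `A`-weighted zero-sum subsequence of consecutive terms. The value is `0` exactly when
there is no such `k`. -/
noncomputable def weightedConstC {R : Type*} [Ring R] (A : Set R) (M : Type*) [AddCommGroup M]
    [Module R M] : ℕ :=
  sInf {k : ℕ | 0 < k ∧ ∀ x : Fin k → M, HasConsecutiveWeightedZeroSum A x}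

/-- The set `S(n)` of squares in `ℤ/nℤ`. -/
def squares (n : ℕ) : Set (ZMod n) := {a | ∃ x : ZMod n, a = x ^ 2}

/-- The set `S(n)^*` of non-zero squares in `ℤ/nℤ`. -/
def nonzeroSquares (n : ℕ) : Set (ZMod n) := squares n \ {0}

/-! Upper bound: write `m = p * q` with `p` prime. The weights `(q * y) ^ 2` with `p ∤ y` are
nonzero modulo `m ^ 2` and divisible by `q ^ 2`, so it suffices to find, among nine integers, an
interval with a relation modulo `p ^ 2` weighted by unit squares (`exists_interval_sq_dvd`). This
rests on ternary diagonal forms modulo `p` and a Hensel lift.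

Lower bound: with `x ^ 2 + c * y ^ 2` anisotropic modulo `m`, the sequence `m, mc, 1, m, mc, c, m,
mc` has no good interval. Reduction modulo `m` excludes the terms `1` and `c`, and each remaining
pair `m, mc` is the same form scaled by `m`. -/

/-! ### Upper bound: relations modulo `p` and `p ^ 2` -/

/-- Over a finite field of odd characteristic, three nonzero coefficients admit a diagonal quadratic
relation with all variables nonzero, involving the first two, the last two, or all three of them. -/
theorem exists_sq_relation {p : ℕ} [Fact p.Prime] (hp : p ≠ 2) {u v w : ZMod p}
    (hu : u ≠ 0) (hv : v ≠ 0) (hw : w ≠ 0) :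
    (∃ x y : ZMod p, x ≠ 0 ∧ y ≠ 0 ∧ x ^ 2 * u + y ^ 2 * v = 0) ∨
    (∃ y z : ZMod p, y ≠ 0 ∧ z ≠ 0 ∧ y ^ 2 * v + z ^ 2 * w = 0) ∨
    (∃ x y z : ZMod p, x ≠ 0 ∧ y ≠ 0 ∧ z ≠ 0 ∧ x ^ 2 * u + y ^ 2 * v + z ^ 2 * w = 0) := by
  have h2 : (2 : ZMod p) ≠ 0 := by
    intro h
    have : ((2 : ℕ) : ZMod p) = 0 := by exact_mod_cast h
    rw [ZMod.natCast_eq_zero_iff] at this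
    exact hp ((Nat.prime_dvd_prime_iff_eq Fact.out Nat.prime_two).mp this)
  by_cases huv : ∃ x y : ZMod p, x ≠ 0 ∧ y ≠ 0 ∧ x ^ 2 * u + y ^ 2 * v = 0
  · exact Or.inl huv
  by_cases hvw : ∃ y z : ZMod p, y ≠ 0 ∧ z ≠ 0 ∧ y ^ 2 * v + z ^ 2 * w = 0
  · exact Or.inr (Or.inl hvw)
  refine Or.inr (Or.inr ?_)
  -- Solve with third variable 1; only a vanishing `a` or `b` then needs repair.
  obtain ⟨a, b, hab⟩ : ∃ a b : ZMod p, a ^ 2 + b ^ 2 * (v / u) = -(w / u) := by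
    have hc : v / u ≠ 0 := div_ne_zero hv hu
    have hodd : Fintype.card (ZMod p) % 2 = 1 := by
      rw [ZMod.card]
      exact ((Fact.out : p.Prime).eq_two_or_odd).resolve_left hp
    obtain ⟨a, b, h⟩ := FiniteField.exists_root_sum_quadratic
      (f := Polynomial.X ^ 2) (g := Polynomial.C (v / u) * Polynomial.X ^ 2 + Polynomial.C 0 *
        Polynomial.X + Polynomial.C (w / u)) (Polynomial.degree_X_pow 2)
      (Polynomial.degree_quadratic hc) hodd
    refine ⟨a, b, ?_⟩
    simp at h
    linear_combination h
  have hrel : a ^ 2 * u + b ^ 2 * v + w = 0 := by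
    field_simp at hab
    linear_combination hab
  by_cases ha : a = 0
  · subst ha
    have hb : b ≠ 0 := by
      rintro rfl
      exact hw (by simpa using hrel)
    exact absurd ⟨b, 1, hb, one_ne_zero, by linear_combination hrel⟩ hvw
  by_cases hb : b = 0
  · subst hb
    have hne1 : u - v ≠ 0 := fun h => hvw
      ⟨a, 1, ha, one_ne_zero, by linear_combination hrel - a ^ 2 * h⟩
    have hne2 : u + v ≠ 0 := fun h => huv
      ⟨1, 1, one_ne_zero, one_ne_zero, by linear_combination h⟩
    -- Here `w = -a ^ 2 * u`, and the witness comes from `(u - v) ^ 2 + 4 * u * v = (u + v) ^ 2`.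
    refine ⟨u - v, 2 * u, (u + v) / a, hne1, mul_ne_zero h2 hu, div_ne_zero hne2 ha, ?_⟩
    field_simp
    linear_combination (u + v) ^ 2 * hrel
  · exact ⟨a, b, 1, ha, hb, one_ne_zero, by linear_combination hrel⟩

theorem exists_int_lift {p : ℕ} {x : ZMod p} (hx : x ≠ 0) :
    ∃ a : ℤ, ¬ (p : ℤ) ∣ a ∧ (a : ZMod p) = x := by
  obtain ⟨a, rfl⟩ := ZMod.intCast_surjective x
  exact ⟨a, fun h => hx ((ZMod.intCast_zmod_eq_zero_iff_dvd a p).mpr h), rfl⟩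

/-- If `i < j < k` are the only indices in `[i, k]` at which `f` is prime to `p`, then one of the
intervals between them carries a relation modulo `p` weighted by squares of units. -/
theorem exists_interval_dvd {p : ℕ} [Fact p.Prime] (hp : p ≠ 2) (f : ℕ → ℤ) {i j k : ℕ}
    (hij : i < j) (hjk : j < k) (hi : ¬ (p : ℤ) ∣ f i) (hj : ¬ (p : ℤ) ∣ f j)
    (hk : ¬ (p : ℤ) ∣ f k)
    (hother : ∀ l, i < l → l < k → l ≠ j → (p : ℤ) ∣ f l) :
    ∃ a b : ℕ, i ≤ a ∧ a ≤ b ∧ b ≤ k ∧ (a = i ∨ a = j) ∧ ∃ y : ℕ → ℤ, (∀ l, ¬ (p : ℤ) ∣ y l) ∧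
      (p : ℤ) ∣ ∑ l ∈ Finset.Icc a b, y l ^ 2 * f l := by
  have hone : ¬ (p : ℤ) ∣ 1 := by
    intro h
    exact (Fact.out : p.Prime).one_lt.ne' (by exact_mod_cast Int.eq_one_of_dvd_one (by positivity) h)
  have hcast : ∀ z : ℤ, (z : ZMod p) = 0 ↔ (p : ℤ) ∣ z := fun z =>
    ZMod.intCast_zmod_eq_zero_iff_dvd z p
  have key : ∀ X Y Z : ℤ, ¬ (p : ℤ) ∣ X → ¬ (p : ℤ) ∣ Y → ¬ (p : ℤ) ∣ Z → ∀ a b, i ≤ a → b ≤ k →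
      ∃ y : ℕ → ℤ, y i = X ∧ y j = Y ∧ y k = Z ∧ (∀ l, ¬ (p : ℤ) ∣ y l) ∧
      ∀ s : Finset ℕ, s ⊆ Finset.Icc a b → (∀ l ∈ Finset.Icc a b, l = i ∨ l = j ∨ l = k → l ∈ s) →
        (((∑ l ∈ Finset.Icc a b, y l ^ 2 * f l : ℤ)) : ZMod p) =
          ∑ l ∈ s, (y l : ZMod p) ^ 2 * (f l : ZMod p) := by
    intro X Y Z hX hY hZ a b ha hb
    refine ⟨fun l => if l = i then X else if l = j then Y else if l = k then Z else 1,
      by simp, by simp [hij.ne'], by simp [hjk.ne', (hij.trans hjk).ne'], ?_, ?_⟩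
    · intro l
      dsimp only
      split_ifs <;> assumption
    · intro s hs hs'
      push_cast
      refine (Finset.sum_subset hs fun l hl hls => ?_).symm
      have hlne : ¬ (l = i ∨ l = j ∨ l = k) := fun h => hls (hs' l hl h)
      push Not at hlne
      rw [Finset.mem_Icc] at hl
      rw [(hcast (f l)).mpr (hother l (by omega) (by omega) hlne.2.1), mul_zero]
  have hne : ∀ {z : ℤ}, ¬ (p : ℤ) ∣ z → (z : ZMod p) ≠ 0 := fun h h' => h ((hcast _).mp h')
  rcases exists_sq_relation hp (hne hi) (hne hj) (hne hk) with
    ⟨x, y, hx, hy, h⟩ | ⟨y, z, hy, hz, h⟩ | ⟨x, y, z, hx, hy, hz, h⟩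
  · obtain ⟨X, hX, rfl⟩ := exists_int_lift hx
    obtain ⟨Y, hY, rfl⟩ := exists_int_lift hy
    obtain ⟨g, gi, gj, -, hg, hs⟩ := key X Y 1 hX hY hone i j le_rfl hjk.le
    refine ⟨i, j, le_rfl, hij.le, hjk.le, Or.inl rfl, g, hg, ?_⟩
    rw [← hcast, hs {i, j} (by grind) (by grind), Finset.sum_pair hij.ne, gi, gj, h]
  · obtain ⟨Y, hY, rfl⟩ := exists_int_lift hy
    obtain ⟨Z, hZ, rfl⟩ := exists_int_lift hz
    obtain ⟨g, -, gj, gk, hg, hs⟩ := key 1 Y Z hone hY hZ j k hij.le le_rfl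
    refine ⟨j, k, hij.le, hjk.le, le_rfl, Or.inr rfl, g, hg, ?_⟩
    rw [← hcast, hs {j, k} (by grind) (by grind), Finset.sum_pair hjk.ne, gj, gk, h]
  · obtain ⟨X, hX, rfl⟩ := exists_int_lift hx
    obtain ⟨Y, hY, rfl⟩ := exists_int_lift hy
    obtain ⟨Z, hZ, rfl⟩ := exists_int_lift hz
    obtain ⟨g, gi, gj, gk, hg, hs⟩ := key X Y Z hX hY hZ i k le_rfl le_rfl
    refine ⟨i, k, le_rfl, (hij.trans hjk).le, le_rfl, Or.inl rfl, g, hg, ?_⟩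
    have hsub : ({i, j, k} : Finset ℕ) ⊆ Finset.Icc i k := fun l hl => by
      simp only [Finset.mem_insert, Finset.mem_singleton] at hl
      rw [Finset.mem_Icc]
      omega
    have hi' : i ∉ ({j, k} : Finset ℕ) := by
      simp only [Finset.mem_insert, Finset.mem_singleton]
      omega
    rw [← hcast, hs {i, j, k} hsub fun l _ hl => by simpa using hl, Finset.sum_insert hi',
      Finset.sum_pair hjk.ne, gi, gj, gk, ← add_assoc, h]

/-- A relation modulo `p` weighted by squares of units, with a coefficient prime to `p`, lifts to
a relation modulo `p ^ 2`. -/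
theorem exists_lift_sq_dvd {p : ℕ} [Fact p.Prime] (hp : p ≠ 2) (f y : ℕ → ℤ) {s : Finset ℕ}
    {c : ℕ} (hc : c ∈ s) (hfc : ¬ (p : ℤ) ∣ f c) (hy : ∀ l, ¬ (p : ℤ) ∣ y l)
    (h : (p : ℤ) ∣ ∑ l ∈ s, y l ^ 2 * f l) :
    ∃ y' : ℕ → ℤ, (∀ l, ¬ (p : ℤ) ∣ y' l) ∧ (p : ℤ) ^ 2 ∣ ∑ l ∈ s, y' l ^ 2 * f l := by
  have hpp : Prime (p : ℤ) := Nat.prime_iff_prime_int.mp Fact.out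
  obtain ⟨q, hq⟩ := h
  have h2 : ¬ (p : ℤ) ∣ 2 := by
    intro h
    exact hp ((Nat.prime_dvd_prime_iff_eq Fact.out Nat.prime_two).mp (by exact_mod_cast h))
  have hcop : IsCoprime (p : ℤ) (2 * y c * f c) := by
    rw [hpp.coprime_iff_not_dvd]
    intro hd
    rcases hpp.dvd_or_dvd hd with hd | hd
    · exact (hpp.dvd_or_dvd hd).elim h2 (hy c)
    · exact hfc hd
  obtain ⟨r, t, hrt⟩ := hcop
  -- Newton step: `t` inverts `2 * y c * f c` modulo `p`, so shifting `y c` by `-p * q * t` cancels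
  -- the sum `p * q` modulo `p ^ 2`.
  refine ⟨Function.update y c (y c + p * (-q * t)), fun l => ?_, ?_⟩
  · by_cases hl : l = c
    · subst hl
      rw [Function.update_self]
      exact fun hd => hy l ((dvd_add_left (dvd_mul_right _ _)).mp hd)
    · rw [Function.update_of_ne hl]
      exact hy l
  · rw [← Finset.add_sum_erase _ _ hc] at hq ⊢
    rw [Finset.sum_congr rfl (g := fun l => y l ^ 2 * f l) fun l hl => by
      rw [Function.update_of_ne (Finset.ne_of_mem_erase hl)], Function.update_self]
    refine ⟨q * r + q ^ 2 * t ^ 2 * f c, ?_⟩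
    linear_combination hq - p * q * hrt

/-- If three consecutive terms are divisible by `p`, divide them by `p` and work modulo `p`.
Otherwise each third of the nine terms contains a unit; a unit of the middle third and its nearest
unit on each side give a relation modulo `p`, which lifts. -/
theorem exists_interval_sq_dvd {p : ℕ} [Fact p.Prime] (hp : p ≠ 2) (f : ℕ → ℤ) :
    ∃ a b : ℕ, a ≤ b ∧ b < 9 ∧ ∃ y : ℕ → ℤ, (∀ l, ¬ (p : ℤ) ∣ y l) ∧
      (p : ℤ) ^ 2 ∣ ∑ l ∈ Finset.Icc a b, y l ^ 2 * f l := by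
  by_cases hblock : ∃ i ≤ 6, ∀ l, i ≤ l → l ≤ i + 2 → (p : ℤ) ∣ f l
  · obtain ⟨i, hi, hdiv⟩ := hblock
    have hex : ∀ l, ∃ g : ℤ, i ≤ l → l ≤ i + 2 → f l = p * g := fun l => by
      by_cases hl : i ≤ l ∧ l ≤ i + 2
      · obtain ⟨g, hg⟩ := hdiv l hl.1 hl.2
        exact ⟨g, fun _ _ => hg⟩
      · exact ⟨0, fun h1 h2 => absurd ⟨h1, h2⟩ hl⟩
    choose g hg using hex
    have hone : ¬ (p : ℤ) ∣ 1 := (Nat.prime_iff_prime_int.mp (Fact.out : p.Prime)).not_dvd_one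
    suffices h : ∃ a b : ℕ, i ≤ a ∧ a ≤ b ∧ b ≤ i + 2 ∧ ∃ y : ℕ → ℤ, (∀ l, ¬ (p : ℤ) ∣ y l) ∧
        (p : ℤ) ∣ ∑ l ∈ Finset.Icc a b, y l ^ 2 * g l by
      obtain ⟨a, b, ha, hab, hb, y, hy, hdvd⟩ := h
      refine ⟨a, b, hab, by omega, y, hy, ?_⟩
      rw [Finset.sum_congr rfl (g := fun l => p * (y l ^ 2 * g l)) fun l hl => by
        rw [Finset.mem_Icc] at hl
        rw [hg l (by omega) (by omega)]
        ring, ← Finset.mul_sum, sq]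
      exact mul_dvd_mul_left _ hdvd
    by_cases hz : ∃ l, i ≤ l ∧ l ≤ i + 2 ∧ (p : ℤ) ∣ g l
    · obtain ⟨l, h1, h2, h3⟩ := hz
      exact ⟨l, l, h1, le_rfl, h2, fun _ => 1, fun _ => hone, by simpa using h3⟩
    · push Not at hz
      obtain ⟨a, b, ha, hab, hb, -, h⟩ := exists_interval_dvd hp g (Nat.lt_succ_self i)
        (Nat.lt_succ_self (i + 1)) (hz i (by omega) (by omega)) (hz (i + 1) (by omega) (by omega))
        (hz (i + 2) (by omega) (by omega)) (by omega)
      exact ⟨a, b, ha, hab, hb, h⟩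
  · push Not at hblock
    obtain ⟨j, hj3, hj5, hj⟩ := hblock 3 (by omega)
    have hleft : ∃ i < j, ¬ (p : ℤ) ∣ f i ∧ ∀ l, i < l → l < j → (p : ℤ) ∣ f l := by
      classical
      obtain ⟨i, hi0, hi2, hi⟩ := hblock 0 (by omega)
      have hspec := Nat.findGreatest_spec (P := fun l => ¬ (p : ℤ) ∣ f l)
        (show i ≤ j - 1 by omega) hi
      refine ⟨_, lt_of_le_of_lt (Nat.findGreatest_le (j - 1)) (by omega), hspec, fun l h1 h2 => ?_⟩
      exact not_not.mp (Nat.findGreatest_is_greatest h1 (by omega))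
    have hright : ∃ k, j < k ∧ k < 9 ∧ ¬ (p : ℤ) ∣ f k ∧
        ∀ l, j < l → l < k → (p : ℤ) ∣ f l := by
      classical
      obtain ⟨k, hk6, hk8, hk⟩ := hblock 6 (by omega)
      have hex : ∃ k, j < k ∧ ¬ (p : ℤ) ∣ f k := ⟨k, by omega, hk⟩
      refine ⟨Nat.find hex, (Nat.find_spec hex).1,
        lt_of_le_of_lt (Nat.find_min' hex ⟨by omega, hk⟩) (by omega), (Nat.find_spec hex).2, ?_⟩
      intro l h1 h2
      by_contra h
      exact Nat.find_min hex h2 ⟨h1, h⟩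
    obtain ⟨i, hij, hi, hi'⟩ := hleft
    obtain ⟨k, hjk, hk9, hk, hk'⟩ := hright
    obtain ⟨a, b, ha, hab, hb, haij, y, hy, hdvd⟩ := exists_interval_dvd hp f hij hjk hi hj hk
      fun l h1 h2 h3 => by
        rcases lt_or_gt_of_ne h3 with h | h
        · exact hi' l h1 h
        · exact hk' l h h2
    -- The interval starts at a unit, as the lift requires.
    have hfa : ¬ (p : ℤ) ∣ f a := by rcases haij with rfl | rfl <;> assumption
    exact ⟨a, b, hab, by omega,
      exists_lift_sq_dvd hp f y (Finset.left_mem_Icc.mpr hab) hfa hy hdvd⟩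

/-! ### Lower bound: an avoiding sequence of length eight -/

/-- Modulo an odd squarefree `m` there is an anisotropic diagonal binary quadratic form. -/
theorem exists_anisotropic {m : ℕ} (hm_odd : Odd m) (hm_sqf : Squarefree m) :
    ∃ b : ℤ, ∀ x y : ℤ, (m : ℤ) ∣ x ^ 2 + b * y ^ 2 → (m : ℤ) ∣ x ∧ (m : ℤ) ∣ y := by
  have hloc : ∀ p : ℕ, ∃ c : ℕ, p ∈ m.primeFactors → ∀ x y : ZMod p,
      x ^ 2 + c * y ^ 2 = 0 → x = 0 ∧ y = 0 := by
    intro p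
    by_cases hp : p ∈ m.primeFactors
    · have hpp := Nat.prime_of_mem_primeFactors hp
      have : Fact p.Prime := ⟨hpp⟩
      have hp2 : p ≠ 2 := by
        rintro rfl
        exact (Nat.not_even_iff_odd.mpr hm_odd)
          (even_iff_two_dvd.mpr (Nat.dvd_of_mem_primeFactors hp))
      -- For a nonsquare `a`, `x ^ 2 = a * y ^ 2` has only the trivial solution; the coefficients
      -- `-a` are glued below by the Chinese remainder theorem.
      obtain ⟨a, ha⟩ := FiniteField.exists_nonsquare (F := ZMod p) (by rwa [ZMod.ringChar_zmod_n])
      refine ⟨(-a).val, fun _ x y h => ?_⟩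
      rw [ZMod.natCast_zmod_val] at h
      have hy : y = 0 := by
        by_contra hy
        refine ha ⟨x / y, ?_⟩
        field_simp
        linear_combination -h
      subst hy
      exact ⟨by simpa using h, rfl⟩
    · exact ⟨0, fun h => absurd h hp⟩
  choose c hc using hloc
  obtain ⟨b, hb⟩ := Nat.chineseRemainderOfFinset c id m.primeFactors
    (fun p hp => (Nat.prime_of_mem_primeFactors hp).ne_zero)
    (fun p hp q hq hpq => (Nat.coprime_primes (Nat.prime_of_mem_primeFactors hp)
      (Nat.prime_of_mem_primeFactors hq)).mpr hpq)
  refine ⟨b, fun x y h => ?_⟩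
  have hdvd : ∀ z : ℤ, (∀ p ∈ m.primeFactors, (p : ℤ) ∣ z) → (m : ℤ) ∣ z := by
    intro z hz
    rw [← Nat.prod_primeFactors_of_squarefree hm_sqf, Int.natCast_dvd]
    exact Finset.prod_primes_dvd _ (fun p hp => (Nat.prime_of_mem_primeFactors hp).prime)
      fun p hp => Int.natCast_dvd.mp (hz p hp)
  have hboth : ∀ p ∈ m.primeFactors, (p : ℤ) ∣ x ∧ (p : ℤ) ∣ y := by
    intro p hp
    have hpm : (p : ℤ) ∣ m := by exact_mod_cast Nat.dvd_of_mem_primeFactors hp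
    have h0 := (ZMod.intCast_zmod_eq_zero_iff_dvd _ p).mpr (hpm.trans h)
    have hbc : (b : ZMod p) = c p := (ZMod.natCast_eq_natCast_iff _ _ _).mpr (hb p hp)
    push_cast at h0
    rw [hbc] at h0
    simpa only [ZMod.intCast_zmod_eq_zero_iff_dvd] using hc p hp x y h0
  exact ⟨hdvd x fun p hp => (hboth p hp).1, hdvd y fun p hp => (hboth p hp).2⟩

/-- A sequence of length eight on which no interval carries a relation modulo `m ^ 2` weighted by
squares of integers not divisible by `m`. -/
theorem exists_avoiding_sequence {m : ℕ} (hm_odd : Odd m) (hm_sqf : Squarefree m) :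
    ∃ w : ℕ → ℤ, ∀ (z : ℕ → ℤ) (a b : ℕ), a ≤ b → b < 8 →
      (∀ l ∈ Finset.Icc a b, ¬ (m : ℤ) ∣ z l) →
      ¬ (m : ℤ) ^ 2 ∣ ∑ l ∈ Finset.Icc a b, z l ^ 2 * w l := by
  obtain ⟨c, hc⟩ := exists_anisotropic hm_odd hm_sqf
  have hm0 : (m : ℤ) ≠ 0 := by exact_mod_cast hm_sqf.ne_zero
  have hc' : ∀ x y : ℤ, (m : ℤ) ^ 2 ∣ m * (x ^ 2 + c * y ^ 2) → (m : ℤ) ∣ x ∧ (m : ℤ) ∣ y := by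
    intro x y h
    rw [sq (m : ℤ)] at h
    exact hc x y ((mul_dvd_mul_iff_left hm0).mp h)
  refine ⟨fun l => if l = 2 then 1 else if l = 5 then c else if l % 3 = 0 then m else m * c, ?_⟩
  intro z a b hab hb hz hdvd
  -- Extending by zero treats every interval through one eight-term sum.
  let Z : ℕ → ℤ := fun l => if l ∈ Finset.Icc a b then z l else 0
  have hin : ∀ l, a ≤ l → l ≤ b → ¬ (m : ℤ) ∣ Z l := fun l h1 h2 => by
    have hl := Finset.mem_Icc.mpr ⟨h1, h2⟩
    simpa only [Z, if_pos hl] using hz l hl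
  have hout : ∀ l, ¬ (a ≤ l ∧ l ≤ b) → Z l = 0 := fun l h => by
    simp only [Z, Finset.mem_Icc, if_neg h]
  have hsum : (m : ℤ) ^ 2 ∣ Z 0 ^ 2 * m + Z 1 ^ 2 * (m * c) + Z 2 ^ 2 + Z 3 ^ 2 * m +
      Z 4 ^ 2 * (m * c) + Z 5 ^ 2 * c + Z 6 ^ 2 * m + Z 7 ^ 2 * (m * c) := by
    convert hdvd using 1
    rw [Finset.sum_congr rfl (g := fun l => Z l ^ 2 * (if l = 2 then 1 else if l = 5 then c else
      if l % 3 = 0 then (m : ℤ) else m * c)) fun l hl => by simp only [Z, if_pos hl],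
      Finset.sum_subset (s₂ := Finset.range 8) (by grind) fun l _ hl => by
        simp only [Z, if_neg hl]
        ring]
    simp [Finset.sum_range_succ]
  -- Modulo `m` only positions 2 and 5 survive, with coefficients `1` and `c`.
  have h25 : (m : ℤ) ∣ Z 2 ∧ (m : ℤ) ∣ Z 5 := by
    apply hc
    have h := (dvd_pow_self (m : ℤ) two_ne_zero).trans hsum
    refine (dvd_add_right (b := (m : ℤ) * (Z 0 ^ 2 + Z 1 ^ 2 * c + Z 3 ^ 2 + Z 4 ^ 2 * c + Z 6 ^ 2 +
      Z 7 ^ 2 * c)) (dvd_mul_right _ _)).mp ?_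
    convert h using 1
    ring
  have h2 : ¬ (a ≤ 2 ∧ 2 ≤ b) := fun h => hin 2 h.1 h.2 h25.1
  have h5 : ¬ (a ≤ 5 ∧ 5 ≤ b) := fun h => hin 5 h.1 h.2 h25.2
  rw [hout 2 h2, hout 5 h5] at hsum
  have hcases : b ≤ 1 ∨ (3 ≤ a ∧ b ≤ 4) ∨ 6 ≤ a := by omega
  rcases hcases with h | h | h
  · rw [hout 3 (by omega), hout 4 (by omega), hout 6 (by omega), hout 7 (by omega)] at hsum
    have := hc' (Z 0) (Z 1) (by convert hsum using 1; ring)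
    have ha : a = 0 ∨ a = 1 := by omega
    rcases ha with rfl | rfl
    · exact hin 0 le_rfl hab this.1
    · exact hin 1 le_rfl hab this.2
  · rw [hout 0 (by omega), hout 1 (by omega), hout 6 (by omega), hout 7 (by omega)] at hsum
    have := hc' (Z 3) (Z 4) (by convert hsum using 1; ring)
    have ha : a = 3 ∨ a = 4 := by omega
    rcases ha with rfl | rfl
    · exact hin 3 le_rfl hab this.1
    · exact hin 4 le_rfl hab this.2
  · rw [hout 0 (by omega), hout 1 (by omega), hout 3 (by omega), hout 4 (by omega)] at hsum
    have := hc' (Z 6) (Z 7) (by convert hsum using 1; ring)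
    have ha : a = 6 ∨ a = 7 := by omega
    rcases ha with rfl | rfl
    · exact hin 6 le_rfl hab this.1
    · exact hin 7 le_rfl hab this.2

/-! ### Transfer to residues modulo `m ^ 2` -/

theorem Fin.sum_Icc_val {M : Type*} [AddCommMonoid M] {k : ℕ} (i j : Fin k) (g : ℕ → M) :
    ∑ l ∈ Finset.Icc i j, g l = ∑ l ∈ Finset.Icc (i : ℕ) j, g l := by
  rw [← Fin.map_valEmbedding_Icc, Finset.sum_map]
  rfl

theorem hasConsecutiveWeightedZeroSum_nonzeroSquares {m : ℕ} (hm_odd : Odd m)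
    (hm_sqf : Squarefree m) (hm_one : m ≠ 1) (x : Fin 9 → ZMod (m ^ 2)) :
    HasConsecutiveWeightedZeroSum (nonzeroSquares (m ^ 2)) x := by
  obtain ⟨p, hp, q, rfl⟩ := Nat.exists_prime_and_dvd hm_one
  have : Fact p.Prime := ⟨hp⟩
  have hp2 : p ≠ 2 := by
    rintro rfl
    exact (Nat.not_even_iff_odd.mpr hm_odd) (even_two_mul q)
  have hpp : Prime (p : ℤ) := Nat.prime_iff_prime_int.mp hp
  -- Squarefreeness keeps `p` out of `q`, so the weights `(q * y l) ^ 2` are nonzero.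
  have hpq : ¬ (p : ℤ) ∣ q := by
    intro h
    have h' : p ∣ q := by exact_mod_cast h
    exact hp.not_isUnit (hm_sqf p (mul_dvd_mul_left p h'))
  choose X hX using fun l => ZMod.intCast_surjective (x l)
  let f : ℕ → ℤ := fun l => if h : l < 9 then X ⟨l, h⟩ else 0
  obtain ⟨a, b, hab, hb, y, hy, hdvd⟩ := exists_interval_sq_dvd hp2 f
  refine ⟨⟨a, by omega⟩, ⟨b, hb⟩, Finset.nonempty_Icc.mpr hab,
    fun l => (((q * y l : ℤ) : ZMod ((p * q) ^ 2))) ^ 2, fun l _ => ⟨⟨_, rfl⟩, ?_⟩, ?_⟩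
  · dsimp only
    rw [Set.mem_singleton_iff, ← Int.cast_pow, ZMod.intCast_zmod_eq_zero_iff_dvd]
    intro h
    have h1 : (p : ℤ) ∣ (q * y l) ^ 2 :=
      Dvd.dvd.trans ⟨p * q ^ 2, by push_cast; ring⟩ h
    exact (hpp.dvd_or_dvd (hpp.dvd_of_dvd_pow h1)).elim hpq (hy l)
  · have hterm : ∀ l : Fin 9, (((q * y l : ℤ) : ZMod ((p * q) ^ 2))) ^ 2 • x l =
        (((q * y l) ^ 2 * f l : ℤ) : ZMod ((p * q) ^ 2)) := by
      intro l
      have hf : f l = X l := by simp [f]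
      rw [hf, smul_eq_mul, ← hX l]
      push_cast
      ring
    rw [Finset.sum_congr rfl fun l _ => hterm l,
      Fin.sum_Icc_val _ _ fun l => (((q * y l) ^ 2 * f l : ℤ) : ZMod ((p * q) ^ 2)),
      ← Int.cast_sum, ZMod.intCast_zmod_eq_zero_iff_dvd]
    simp only [mul_pow, mul_assoc, ← Finset.mul_sum]
    push_cast
    rw [mul_comm]
    exact mul_dvd_mul_left _ hdvd

/-- Prefixes of the eight-term sequence serve all shorter lengths. A square `z ^ 2` that is nonzero
modulo `m ^ 2` has `m ∤ z`. -/
theorem exists_not_hasConsecutiveWeightedZeroSum {m : ℕ} (hm_odd : Odd m)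
    (hm_sqf : Squarefree m) {k : ℕ} (hk : k < 9) :
    ∃ x : Fin k → ZMod (m ^ 2),
      ¬ HasConsecutiveWeightedZeroSum (nonzeroSquares (m ^ 2)) x := by
  obtain ⟨w, hw⟩ := exists_avoiding_sequence hm_odd hm_sqf
  refine ⟨fun l => (w l : ZMod (m ^ 2)), ?_⟩
  rintro ⟨i, j, hne, a, ha, hsum⟩
  have hex : ∀ l : ℕ, ∃ z : ℤ, ∀ h : l < k, (⟨l, h⟩ : Fin k) ∈ Finset.Icc i j →
      ¬ (m : ℤ) ∣ z ∧ a ⟨l, h⟩ = (z : ZMod (m ^ 2)) ^ 2 := by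
    intro l
    by_cases hl : ∃ h : l < k, (⟨l, h⟩ : Fin k) ∈ Finset.Icc i j
    · obtain ⟨h, hmem⟩ := hl
      obtain ⟨⟨s, hs⟩, h0⟩ := ha _ hmem
      obtain ⟨z, rfl⟩ := ZMod.intCast_surjective s
      refine ⟨z, fun _ _ => ⟨fun hd => h0 ?_, hs⟩⟩
      rw [Set.mem_singleton_iff, hs, ← Int.cast_pow, ZMod.intCast_zmod_eq_zero_iff_dvd]
      push_cast
      exact pow_dvd_pow_of_dvd hd 2
    · exact ⟨0, fun h hmem => absurd ⟨h, hmem⟩ hl⟩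
  choose z hz using hex
  have hj := j.isLt
  refine hw z i j (Fin.le_def.mp (Finset.nonempty_Icc.mp hne)) (by omega) (fun l hl => ?_) ?_
  · rw [Finset.mem_Icc] at hl
    exact (hz l (by omega) (Finset.mem_Icc.mpr hl)).1
  · rw [Finset.sum_congr rfl (g := fun l : Fin k => ((z l ^ 2 * w l : ℤ) : ZMod (m ^ 2)))
      fun l hl => by
        rw [(hz l l.isLt hl).2, smul_eq_mul]
        push_cast
        rfl,
      Fin.sum_Icc_val _ _ fun l => ((z l ^ 2 * w l : ℤ) : ZMod (m ^ 2)),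
      ← Int.cast_sum, ZMod.intCast_zmod_eq_zero_iff_dvd] at hsum
    exact_mod_cast hsum

theorem mainTheorem2 (n m : ℕ) (hn : n = m ^ 2) (hm_odd : Odd m) (hm_sqf : Squarefree m)
    (hm_one : m ≠ 1) :
    weightedConstC (nonzeroSquares n) (ZMod n) = 9 := by
  subst hn
  have hmem : 9 ∈ {k : ℕ | 0 < k ∧ ∀ x : Fin k → ZMod (m ^ 2),
      HasConsecutiveWeightedZeroSum (nonzeroSquares (m ^ 2)) x} :=
    ⟨by norm_num, hasConsecutiveWeightedZeroSum_nonzeroSquares hm_odd hm_sqf hm_one⟩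
  refine le_antisymm (Nat.sInf_le hmem) (le_csInf ⟨9, hmem⟩ fun k hk => ?_)
  by_contra! hlt
  obtain ⟨x, hx⟩ := exists_not_hasConsecutiveWeightedZeroSum hm_odd hm_sqf hlt
  exact hx (hk.2 x)
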